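/- **Setting.** Let $q$ be a power of a prime $p$, let $\mathrm{tr}:\mathbb F_q\to\mathbb F_p$ be the trace, $\omega=e^{2\pi i/p}$, and let $\mathcal H=\mathbb C^q$ have orthonormal basis $\{|j\rangle\}_{j\in\mathbb F_q}$. For $a,b\in\mathbb F_q$ put $\mathsf X(a)=\sum_j|j+a\rangle\langle j|$, $\mathsf Z(b)=\sum_j\omega^{\mathrm{tr}(bj)}|j\rangle\langle j|$. For a finite set $\mathcal A$ and $w=(a,b)\in\mathbb F_q^{\mathcal A}\times\mathbb F_q^{\mathcal A}=\mathbb F_q^{2|\mathcal A|}$ put $\mathbf W_{\mathcal A}(w)=\bigotimes_{i\in\mathcal A}\mathsf X(a_i)\mathsf Z(b_i)$. The symplectic inner product on $\mathbb F_q^{2n}$ is $((x,y),(x',y'))=\mathrm{tr}\sum_i x_iy'_i-\mathrm{tr}\sum_i x'_iy_i$. A matrix $G$ with $2n$ rows is *self-column-orthogonal* if any two vectors of its column space are orthogonal, $(Gy,Gy')=0$ for all $y,y'$. A *stabilizer state* of $G$ is a unit vector $\psi\in\mathcal H^{\otimes n}$ that is an eigenvector of $\mathbf W_{[n]}(Gy)$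 for every $y$. Let $G^{(1)}$ be a $2n\times n$ self-column-orthogonal matrix over $\mathbb F_q$ with linearly independent columns, let $G^{(2)}$ be a $2n\times\ell_2$ matrix and $F$ a $2n\times\ell$ matrix over $\mathbb F_q$, and let $\mathfrak A,\mathfrak B$ be collections of subsets of $[n]$ (for instance an access structure). For $\mathcal A\subset[n]$ let $\overline{\mathcal A}=\mathcal A\cup(\mathcal A+n)\subset[2n]$, and let $\overline{\mathfrak A}=\{\overline{\mathcal A}:\mathcal A\in\mathfrak A\}$, $\overline{\mathfrak B}=\{\overline{\mathcal B}:\mathcal B\in\mathfrak B\}$. For $\mathcal C\subset[2n]$ let $P_{\mathcal C}$ be the projection to the coordinates in $\mathcal C$. Write $G=(G^{(1)},G^{(2)})$. **Theorem.** $G^{(1)}$ has a stabilizer state, and for every stabilizer state $\psi$ of $G^{(1)}$ the following conditions are equivalent. * **(C1)** The linear CQSS protocol with $(G^{(1)},G^{(2)},F)$ is $(\mathfrak A,\mathfrak B)$-secure. In this protocol the shares of the secret $m\in\mathbb F_q^{\ell}$ are the $n$ tensor factors of the state $$\rho[m]=q^{-\ell_2}\sum_{u\in\mathbb F_q^{\ell_2}}\mathbf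 W_{[n]}(Fm+G^{(2)}u)\,|\psi\rangle\langle\psi|\,\mathbf W_{[n]}(Fm+G^{(2)}u)^\dagger ,$$ and, given the shares in $\mathcal A$, the end-user measures the POVM $\{q^{-|\mathcal A|}\,\mathbf W_{\mathcal A}(y)(\mathrm{Tr}_{\mathcal A^c}|\psi\rangle\langle\psi|)\mathbf W_{\mathcal A}(y)^\dagger\}_{y\in\mathbb F_q^{2|\mathcal A|}}$ and computes the secret as a function of the outcome. It is $(\mathfrak A,\mathfrak B)$-secure if for a suitable choice of these functions the end-user outputs $m$ with probability one for every $m$ and every $\mathcal A\in\mathfrak A$, and if $\mathrm{Tr}_{\mathcal B^c}\rho[m]$ does not depend on $m$ for every $\mathcal B\in\mathfrak B$. * **(C2)** The linear classical secret sharing protocol with $(G,F)$ is $(\overline{\mathfrak A},\overline{\mathfrak B})$-secure: if $Z=Fm+GU\in\mathbb F_q^{2n}$ with $U$ uniform on $\mathbb F_q^{n+\ell_2}$, then for every $\mathcal C\in\overline{\mathfrak A}$ some function of $P_{\mathcal C}Z$ equals $m$ with probability one for every $m$, and for every $\mathcal C\in\overline{\mathfrak B}$ the distribution of $P_{\mathcal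 C}Z$ does not depend on $m$. * **(C3)** $(G,F)$ is an $(\overline{\mathfrak A},\overline{\mathfrak B})$-MMSP (multi-target monotone span program): for every $\mathcal C\in\overline{\mathfrak A}$ the columns of $P_{\mathcal C}F$ are linearly independent modulo the column space of $P_{\mathcal C}G$, and for every $\mathcal C\in\overline{\mathfrak B}$ every column of $P_{\mathcal C}F$ lies in the column space of $P_{\mathcal C}G$. -/

import Mathlib

open scoped Matrix Kronecker ComplexOrder

noncomputable section

namespace LinearQSS

/-! ### Weyl operators

`H` is the Hilbert space with orthonormal basis `|j⟩`, `j ∈ K = 𝔽_q`, where `q` is a power of the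
prime `p`. An operator on `H^{⊗ ι}` is a complex matrix indexed by `ι → K`. A vector of
`𝔽_q^{2|ι|}` is a function `w : ι ⊕ ι → K`, read as the pair `(a, b)` with `a i = w (inl i)` and
`b i = w (inr i)`. -/

/-- `X(a) = ∑ j, |j + a⟩⟨j|`. -/
def opX {K : Type*} [Field K] [DecidableEq K] (a : K) : Matrix K K ℂ :=
  fun i j => if i = j + a then 1 else 0

/-- `Z(b) = ∑ j, ω ^ tr (b j) |j⟩⟨j|`, with `ω = exp (2πi/p)` and `tr` the trace of `𝔽_q / 𝔽_p`. -/
def opZ (p : ℕ) [Fact p.Prime] {K : Type*} [Field K] [DecidableEq K] [Algebra (ZMod p) K]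
    (b : K) : Matrix K K ℂ :=
  Matrix.diagonal fun j => ZMod.stdAddChar (Algebra.trace (ZMod p) K (b * j))

/-- The Weyl operator `W(a, b) = ⨂ i, X(a i) Z(b i)` on `H^{⊗ ι}`. -/
def weyl (p : ℕ) [Fact p.Prime] {K : Type*} [Field K] [Fintype K] [DecidableEq K]
    [Algebra (ZMod p) K] {ι : Type*} [Fintype ι] (w : ι ⊕ ι → K) :
    Matrix (ι → K) (ι → K) ℂ :=
  fun x y => ∏ i, (opX (w (Sum.inl i)) * opZ p (w (Sum.inr i))) (x i) (y i)

/-- The symplectic inner product `((x, y), (x', y')) = tr (∑ x i * y' i) - tr (∑ x' i * y i)`. -/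
def symp (p : ℕ) {K : Type*} [Field K] [Algebra (ZMod p) K] {ι : Type*} [Fintype ι]
    (v w : ι ⊕ ι → K) : ZMod p :=
  Algebra.trace (ZMod p) K (∑ i, v (Sum.inl i) * w (Sum.inr i)) -
    Algebra.trace (ZMod p) K (∑ i, w (Sum.inl i) * v (Sum.inr i))

/-- `G` is self-column-orthogonal: its column space `N = {G y : y ∈ 𝔽_q^k}` satisfies `N ⊆ N^⊥`
for the symplectic inner product, i.e. the operators `W(G y)` commute with each other. -/
def SelfColumnOrthogonal (p : ℕ) {K : Type*} [Field K] [Algebra (ZMod p) K] {ι κ : Type*}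
    [Fintype ι] [Fintype κ] (G : Matrix (ι ⊕ ι) κ K) : Prop :=
  ∀ y y' : κ → K, symp p (G *ᵥ y) (G *ᵥ y') = 0

/-- `ψ` is a stabilizer state of `G`: a unit vector that is a common eigenvector of all the
operators `W(G y)`. -/
def IsStabilizerState (p : ℕ) [Fact p.Prime] {K : Type*} [Field K] [Fintype K] [DecidableEq K]
    [Algebra (ZMod p) K] {ι κ : Type*} [Fintype ι] [DecidableEq ι] [Fintype κ]
    (G : Matrix (ι ⊕ ι) κ K) (ψ : (ι → K) → ℂ) : Prop :=
  star ψ ⬝ᵥ ψ = 1 ∧ ∀ y : κ → K, ∃ c : ℂ, weyl p (G *ᵥ y) *ᵥ ψ = c • ψ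

/-! ### Classical-quantum secret sharing

The `n` shares are quantum systems with a basis indexed by `S`; the secret ranges over `M`. -/

/-- `(ι → S) ≃ (A → S) × (Aᶜ → S)`. -/
def splitEquiv {ι : Type*} [DecidableEq ι] (S : Type*) (A : Finset ι) :
    (ι → S) ≃ ({i // i ∈ A} → S) × ({i // i ∉ A} → S) :=
  Equiv.piEquivPiSubtypeProd (fun i => i ∈ A) fun _ => S

/-- The reduced operator `Tr_{Aᶜ} ρ` on the shares in `A`. -/
def reduced {ι S : Type*} [Fintype ι] [DecidableEq ι] [Fintype S] (A : Finset ι)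
    (ρ : Matrix (ι → S) (ι → S) ℂ) :
    Matrix ({i // i ∈ A} → S) ({i // i ∈ A} → S) ℂ :=
  fun x y => ∑ z : {i // i ∉ A} → S,
    ρ ((splitEquiv S A).symm (x, z)) ((splitEquiv S A).symm (y, z))

/-- The operator `Y ⊗ I_{Aᶜ}` on all the shares, for an operator `Y` on the shares in `A`. -/
def extendOp {ι S : Type*} [DecidableEq ι] [DecidableEq S] [Fintype ι] (A : Finset ι)
    (Y : Matrix ({i // i ∈ A} → S) ({i // i ∈ A} → S) ℂ) :
    Matrix (ι → S) (ι → S) ℂ :=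
  Matrix.reindex (splitEquiv S A).symm (splitEquiv S A).symm
    (Y ⊗ₖ (1 : Matrix ({i // i ∉ A} → S) ({i // i ∉ A} → S) ℂ))

/-- A positive-operator valued measure with outcomes in the finite set `M`. -/
def IsPOVM {M X : Type*} [Fintype M] [Fintype X] [DecidableEq X] (Y : M → Matrix X X ℂ) : Prop :=
  (∀ m, (Y m).PosSemidef) ∧ ∑ m, Y m = 1

/-- The data of a CQSS protocol: the state `ρ[m]` of the shares for each secret `m`, and the
measurement `Dec(A)` by which the end-user decodes from the shares in `A`. -/
structure CQSSProtocol (ι S M : Type*) where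
  /-- the joint state `ρ[m]` of the shares -/
  state : M → Matrix (ι → S) (ι → S) ℂ
  /-- the decoder `Dec(A) = {Y_A(m)}` -/
  dec : (A : Finset ι) → M → Matrix ({i // i ∈ A} → S) ({i // i ∈ A} → S) ℂ

/-- `𝔄`-correctness: `Dec(A)` is a measurement that outputs the secret with probability one. -/
def CQSSProtocol.Correct {ι S M : Type*} [Fintype ι] [DecidableEq ι] [Fintype S] [DecidableEq S]
    [Fintype M] (P : CQSSProtocol ι S M) (𝔄 : Set (Finset ι)) : Prop :=
  ∀ A ∈ 𝔄, IsPOVM (P.dec A) ∧ ∀ m, (P.state m * extendOp A (P.dec A m)).trace = 1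

/-- `𝔅`-secrecy: the reduced state on the shares in `B` does not depend on the secret. -/
def CQSSProtocol.Secret {ι S M : Type*} [Fintype ι] [DecidableEq ι] [Fintype S]
    (P : CQSSProtocol ι S M) (𝔅 : Set (Finset ι)) : Prop :=
  ∀ B ∈ 𝔅, ∀ m m', reduced B (P.state m) = reduced B (P.state m')

/-- `(𝔄, 𝔅)`-security of a CQSS protocol. -/
def CQSSProtocol.Secure {ι S M : Type*} [Fintype ι] [DecidableEq ι] [Fintype S] [DecidableEq S]
    [Fintype M] (P : CQSSProtocol ι S M) (𝔄 𝔅 : Set (Finset ι)) : Prop :=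
  P.Correct 𝔄 ∧ P.Secret 𝔅

/-- The pure state `|ψ⟩⟨ψ|`. -/
def pureState {X : Type*} (ψ : X → ℂ) : Matrix X X ℂ := Matrix.vecMulVec ψ (star ψ)

/-- The linear CQSS protocol with `(G⁽¹⁾, G⁽²⁾, F)`, where `ψ` is a stabilizer state of `G⁽¹⁾`.

* The shares for the secret `m` are in the state
  `q ^ (-ℓ₂) ∑ u, W(F m + G⁽²⁾ u) |ψ⟩⟨ψ| W(F m + G⁽²⁾ u)†`.
* From the shares in `A` the end-user performs the measurement with the (normalized) operators
  `q ^ (-|A|) W_A(y) (Tr_{Aᶜ} |ψ⟩⟨ψ|) W_A(y)†`, `y ∈ 𝔽_q^{2|A|}`, and computes the secret as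
  a function `recover A` of the outcome `y`. -/
def linearCQSS (p : ℕ) [Fact p.Prime] {K : Type*} [Field K] [Fintype K] [DecidableEq K]
    [Algebra (ZMod p) K] {n l₂ l : ℕ} (G₂ : Matrix (Fin n ⊕ Fin n) (Fin l₂) K)
    (F : Matrix (Fin n ⊕ Fin n) (Fin l) K) (ψ : (Fin n → K) → ℂ)
    (recover : (A : Finset (Fin n)) →
      ({i // i ∈ A} ⊕ {i // i ∈ A} → K) → (Fin l → K)) :
    CQSSProtocol (Fin n) K (Fin l → K) where
  state m := ((Fintype.card K : ℂ) ^ l₂)⁻¹ • ∑ u : Fin l₂ → K,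
    weyl p (F *ᵥ m + G₂ *ᵥ u) * pureState ψ * (weyl p (F *ᵥ m + G₂ *ᵥ u))ᴴ
  dec A m := ((Fintype.card K : ℂ) ^ A.card)⁻¹ •
    ∑ y : {i // i ∈ A} ⊕ {i // i ∈ A} → K with recover A y = m,
      weyl p y * reduced A (pureState ψ) * (weyl p y)ᴴ

/-! ### Linear classical secret sharing -/

/-- The joint distribution of the shares `Z = F m + G U` of the linear CSS protocol with `(G, F)`
for the secret `m`, where `U` is uniformly distributed. -/
def shareLaw {K : Type*} [Field K] [Fintype K] {ι κ μ : Type*} [Fintype κ] [DecidableEq κ]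
    [Fintype μ] (G : Matrix ι κ K) (F : Matrix ι μ K) (m : μ → K) : PMF (ι → K) :=
  (PMF.uniformOfFintype (κ → K)).map fun u => F *ᵥ m + G *ᵥ u

/-- The projection `P_C` to the coordinates in `C`. -/
def proj {ι K : Type*} (C : Finset ι) (z : ι → K) : {i // i ∈ C} → K := fun i => z i

/-- `(𝔄, 𝔅)`-security of the linear CSS protocol with `(G, F)`: for `A ∈ 𝔄` the shares in `A`
determine the secret with probability one by some decoder, and for `B ∈ 𝔅` the distribution of
the shares in `B` does not depend on the secret. -/
def LinearCSSSecure {K : Type*} [Field K] [Fintype K] {ι κ μ : Type*} [Fintype κ] [DecidableEq κ]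
    [Fintype μ] (G : Matrix ι κ K) (F : Matrix ι μ K) (𝔄 𝔅 : Set (Finset ι)) : Prop :=
  (∀ A ∈ 𝔄, ∃ dec : ({i // i ∈ A} → K) → (μ → K),
      ∀ m, ((shareLaw G F m).map fun z => dec (proj A z)) = PMF.pure m) ∧
    ∀ B ∈ 𝔅, ∀ m m', (shareLaw G F m).map (proj B) = (shareLaw G F m').map (proj B)

/-! ### Multi-target monotone span programs -/

/-- The image `Im P_C G`, spanned by the columns of `P_C G`. -/
def imProj {K : Type*} [Field K] {ι κ : Type*} (C : Finset ι) (G : Matrix ι κ K) :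
    Submodule K ({i // i ∈ C} → K) :=
  Submodule.span K (Set.range fun k => proj C (G.col k))

/-- `(G, F)` is an `(𝔄, 𝔅)`-MMSP: for `A ∈ 𝔄` the columns of `P_A F` are linearly independent
modulo `Im P_A G`, and for `B ∈ 𝔅` the columns of `P_B F` lie in `Im P_B G`. -/
def IsMMSP {K : Type*} [Field K] {ι κ μ : Type*} (G : Matrix ι κ K) (F : Matrix ι μ K)
    (𝔄 𝔅 : Set (Finset ι)) : Prop :=
  (∀ A ∈ 𝔄, LinearIndependent K fun j => (imProj A G).mkQ (proj A (F.col j))) ∧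
    ∀ B ∈ 𝔅, ∀ j, proj B (F.col j) ∈ imProj B G

/-! ### Symplectification -/

/-- The symplectification `{A ⊔ (A + n) : A ∈ 𝔄}` of a collection of subsets of `[n]`. -/
def symplectify {ι : Type*} (𝔄 : Set (Finset ι)) : Set (Finset (ι ⊕ ι)) :=
  (fun A => A.disjSum A) '' 𝔄

end LinearQSS

end

/-! Write `G = (G₁, G₂)` and let `R` be the restriction to the coordinates of the parties in `A`.
All three conditions reduce to two statements of linear algebra: `Determines` (`R (F m) ∈ R (Im G)`
only for `m = 0`) for `A ∈ 𝔄`, and `Masks` (`R (F m) ∈ R (Im G)` for every `m`) for `A ∈ 𝔅`. For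
(C2) and (C3) this is elementary: `linearCSSSecure_iff`, `isMMSP_iff`.

For (C1), let `σ` be the reduced stabilizer state on `A`. By `reduced_weyl_conj` the reduced share
state is the average over `u` of the Weyl translates of `σ` by `R (F m + G₂ u)`. Translations by `R
(Im G₁)` leave `σ` unchanged. Since `Im G₁` is its own symplectic complement, a vector `v` on `A`
orthogonal to `R (Im G₁)` extends by zero into `Im G₁`, so `W(v)` multiplies `σ` by a phase
(`exists_weyl_mul_reduced_eq_smul`). Hence translates of `σ` that do not differ by an element of `R
(Im G₁)` have product zero, and the measurement can only return outcomes in `R (F m + Im G)`, as in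
the classical protocol.

Conversely, if `m ≠ 0` is masked, then `m` and `0` have equal reduced states and cannot both be
decoded. If `m` is not masked, some `W(v)` with `v` orthogonal to `R (Im G)` has different
expectations in the reduced states for `m` and `0`. -/

noncomputable section

namespace LinearQSS

/-! ### Weyl operators: composition, commutation, unitarity and the twirl. -/

section Weyl

variable (p : ℕ) [Fact p.Prime] {K : Type*} [Field K] [Algebra (ZMod p) K]

/-- The additive character `x ↦ ω ^ tr x` of `𝔽_q`. -/
def traceChar (K : Type*) [Field K] [Algebra (ZMod p) K] : AddChar K ℂ :=
  (ZMod.stdAddChar (N := p)).compAddMonoidHom (Algebra.trace (ZMod p) K).toAddMonoidHom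

theorem traceChar_apply (x : K) :
    traceChar p K x = ZMod.stdAddChar (Algebra.trace (ZMod p) K x) := rfl

/-- Evaluation of the trace form is nondegenerate. -/
theorem exists_trace_mul_ne_zero [Finite K] {a : K} (ha : a ≠ 0) :
    ∃ t : K, Algebra.trace (ZMod p) K (t * a) ≠ 0 := by
  have hchar : CharP K p := charP_of_injective_algebraMap (algebraMap (ZMod p) K).injective p
  obtain rfl : ringChar K = p := ringChar.eq K p ▸ rfl
  obtain ⟨t, ht⟩ := FiniteField.trace_to_zmod_nondegenerate K ha
  exact ⟨t, by rwa [mul_comm]⟩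

theorem stdAddChar_ne_one {x : ZMod p} (hx : x ≠ 0) : ZMod.stdAddChar x ≠ (1 : ℂ) := by
  rw [← AddChar.map_zero_eq_one (ZMod.stdAddChar (N := p))]
  exact fun h => hx (ZMod.injective_stdAddChar h)

theorem star_traceChar [Finite K] (x : K) : star (traceChar p K x) = traceChar p K (-x) :=
  ((traceChar p K).map_neg_eq_conj x).symm

theorem traceChar_mul_neg (x : K) : traceChar p K x * traceChar p K (-x) = 1 := by
  rw [← AddChar.map_add_eq_mul, add_neg_cancel, AddChar.map_zero_eq_one]

variable [Fintype K] [DecidableEq K] {ι : Type*} [Fintype ι]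

theorem weyl_apply (w : ι ⊕ ι → K) (x y : ι → K) :
    weyl p w x y =
      if x = y + w ∘ Sum.inl then traceChar p K (∑ i, w (Sum.inr i) * y i) else 0 := by
  have h (i : ι) : (opX (w (Sum.inl i)) * opZ p (w (Sum.inr i))) (x i) (y i) =
      if x i = y i + w (Sum.inl i) then traceChar p K (w (Sum.inr i) * y i) else 0 := by
    simp [opX, opZ, traceChar_apply, Matrix.mul_diagonal]
  simp only [weyl, h]
  split_ifs with hxy
  · subst hxy
    simp only [Pi.add_apply, Function.comp_apply, if_true]
    exact (map_prod (traceChar p K).toMonoidHom _ _).symm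
  · obtain ⟨i, hi⟩ : ∃ i, x i ≠ y i + w (Sum.inl i) := by
      by_contra! hc
      exact hxy (funext hc)
    exact Finset.prod_eq_zero (Finset.mem_univ i) (if_neg hi)

theorem weyl_zero [DecidableEq ι] : weyl p (0 : ι ⊕ ι → K) = 1 := by
  ext x y
  simp only [weyl_apply, Matrix.one_apply]
  congr 1
  · simp [show (0 : ι ⊕ ι → K) ∘ Sum.inl = 0 from rfl]
  · simp

variable [DecidableEq ι]

theorem weyl_mul_apply {Y : Type*} (w : ι ⊕ ι → K) (M : Matrix (ι → K) Y ℂ) (x : ι → K) (y : Y) :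
    (weyl p w * M) x y =
      traceChar p K (∑ i, w (Sum.inr i) * (x i - w (Sum.inl i))) * M (x - w ∘ Sum.inl) y := by
  rw [Matrix.mul_apply, Finset.sum_eq_single (x - w ∘ Sum.inl)]
  · simp [weyl_apply]
  · intro z _ hz
    rw [weyl_apply, if_neg, zero_mul]
    rintro rfl
    simp at hz
  · simp

theorem mul_weyl_conjTranspose_apply {Y : Type*} (w : ι ⊕ ι → K) (M : Matrix Y (ι → K) ℂ)
    (x : Y) (y : ι → K) :
    (M * (weyl p w)ᴴ) x y =
      traceChar p K (-∑ i, w (Sum.inr i) * (y i - w (Sum.inl i))) * M x (y - w ∘ Sum.inl) := by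
  have : M * (weyl p w)ᴴ = (weyl p w * Mᴴ)ᴴ := by simp
  rw [this, Matrix.conjTranspose_apply, weyl_mul_apply, star_mul', star_traceChar]
  simp

/-- `W(v) W(w) = ω ^ (tr (b_v · a_w)) W(v + w)`. -/
theorem weyl_mul_weyl (v w : ι ⊕ ι → K) :
    weyl p v * weyl p w =
      traceChar p K (∑ i, v (Sum.inr i) * w (Sum.inl i)) • weyl p (v + w) := by
  ext x y
  rw [weyl_mul_apply, Matrix.smul_apply, weyl_apply, weyl_apply]
  have h : x - v ∘ Sum.inl = y + w ∘ Sum.inl ↔ x = y + (v + w) ∘ Sum.inl := by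
    rw [sub_eq_iff_eq_add, add_assoc, Pi.add_comp, add_comm (w ∘ _)]
  simp only [h, smul_eq_mul]
  split_ifs with hx
  · subst hx
    rw [← AddChar.map_add_eq_mul, ← AddChar.map_add_eq_mul, ← Finset.sum_add_distrib,
      ← Finset.sum_add_distrib]
    congr 1
    refine Finset.sum_congr rfl fun i _ => ?_
    simp
    ring
  · simp

/-- Both products are multiples of `W(v + w)`; the quotient of the two phases is the symplectic
character. -/
theorem weyl_comm (v w : ι ⊕ ι → K) :
    weyl p v * weyl p w = ZMod.stdAddChar (symp p w v) • (weyl p w * weyl p v) := by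
  rw [weyl_mul_weyl, weyl_mul_weyl, smul_smul, add_comm w v]
  congr 1
  rw [symp, traceChar_apply, traceChar_apply, ← AddChar.map_add_eq_mul]
  congr 1
  simp only [mul_comm]
  ring

theorem weyl_conjTranspose_mul_self (w : ι ⊕ ι → K) : (weyl p w)ᴴ * weyl p w = 1 := by
  rw [mul_eq_one_comm]
  ext x y
  rw [weyl_mul_apply, Matrix.conjTranspose_apply, weyl_apply, Matrix.one_apply]
  by_cases h : x = y
  · subst h
    simp [star_traceChar, traceChar_mul_neg]
  · rw [if_neg, if_neg h] <;> simp [Ne.symm h]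

/-- Character orthogonality: for `z ≠ 0` the summand is a nontrivial character of `b`, because the
trace form is nondegenerate. -/
theorem sum_traceChar_dotProduct (z : ι → K) :
    ∑ b : ι → K, traceChar p K (∑ i, b i * z i) =
      if z = 0 then (Fintype.card K : ℂ) ^ Fintype.card ι else 0 := by
  let φ : AddChar (ι → K) ℂ := (traceChar p K).compAddMonoidHom
    { toFun := fun b => ∑ i, b i * z i
      map_zero' := by simp
      map_add' := fun b c => by simp [add_mul, Finset.sum_add_distrib] }
  have hφ (b : ι → K) : φ b = traceChar p K (∑ i, b i * z i) := rfl
  simp_rw [← hφ]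
  split_ifs with hz
  · subst hz
    simp [hφ]
  · refine AddChar.sum_eq_zero_of_ne_one fun h1 => ?_
    obtain ⟨i, hi⟩ : ∃ i, z i ≠ 0 := Function.ne_iff.1 hz
    obtain ⟨t, ht⟩ := exists_trace_mul_ne_zero p hi
    refine stdAddChar_ne_one p ht ?_
    have := congr($h1 (Pi.single i t))
    rw [hφ, AddChar.one_apply] at this
    simpa [Pi.single_apply, traceChar_apply] using this

/-- The Weyl twirl: averaging over all Weyl operators gives a multiple of the identity. -/
theorem sum_weyl_mul_mul_conjTranspose (σ : Matrix (ι → K) (ι → K) ℂ) :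
    ∑ y : ι ⊕ ι → K, weyl p y * σ * (weyl p y)ᴴ =
      ((Fintype.card K : ℂ) ^ Fintype.card ι * σ.trace) • 1 := by
  ext x x'
  rw [Matrix.sum_apply, Matrix.smul_apply, smul_eq_mul]
  have h (y : ι ⊕ ι → K) : (weyl p y * σ * (weyl p y)ᴴ) x x' =
      traceChar p K (∑ i, y (Sum.inr i) * (x - x') i) *
        σ (x - y ∘ Sum.inl) (x' - y ∘ Sum.inl) := by
    rw [mul_weyl_conjTranspose_apply, weyl_mul_apply, ← mul_assoc, ← AddChar.map_add_eq_mul]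
    congr 2
    rw [← Finset.sum_neg_distrib, ← Finset.sum_add_distrib]
    refine Finset.sum_congr rfl fun i _ => ?_
    rw [Pi.sub_apply]
    ring
  simp_rw [h]
  -- Split `y = (a, b)`: the sum over `b` vanishes unless `x = x'`, and the sum over `a` then runs
  -- through the diagonal of `σ`.
  rw [← (Equiv.sumArrowEquivProdArrow ι ι K).symm.sum_comp, Fintype.sum_prod_type]
  have h2 (a b : ι → K) : (Equiv.sumArrowEquivProdArrow ι ι K).symm (a, b) ∘ Sum.inl = a := rfl
  have h3 (a b : ι → K) (i : ι) :
    (Equiv.sumArrowEquivProdArrow ι ι K).symm (a, b) (Sum.inr i) = b i := rfl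
  simp_rw [h2, h3, ← Finset.sum_mul, sum_traceChar_dotProduct, sub_eq_zero, ← Finset.mul_sum,
    Matrix.one_apply]
  by_cases hx : x = x'
  · subst hx
    simp only [if_true, mul_one, Matrix.trace, Matrix.diag_apply]
    congr 1
    exact (Equiv.subLeft x).sum_comp fun z => σ z z
  · simp [hx]

end Weyl

/-! ### Symplectic duality over `𝔽_q`. -/

section Symplectic

variable (p : ℕ) [Fact p.Prime] {K : Type*} [Field K] [Algebra (ZMod p) K]
  {ι : Type*} [Fintype ι]

/-- The `𝔽_q`-valued symplectic form, whose trace is `symp`. -/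
def sympForm (K : Type*) [Field K] (ι : Type*) [Fintype ι] : LinearMap.BilinForm K (ι ⊕ ι → K) :=
  LinearMap.mk₂ K
    (fun v w => ∑ i, v (Sum.inl i) * w (Sum.inr i) - ∑ i, w (Sum.inl i) * v (Sum.inr i))
    (fun _ _ _ => by simp only [Pi.add_apply, add_mul, mul_add, Finset.sum_add_distrib]; ring)
    (fun _ _ _ => by
      simp only [Pi.smul_apply, smul_eq_mul, mul_sub, Finset.mul_sum]
      congr 1 <;> exact Finset.sum_congr rfl fun _ _ => by ring)
    (fun _ _ _ => by simp only [Pi.add_apply, add_mul, mul_add, Finset.sum_add_distrib]; ring)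
    (fun _ _ _ => by
      simp only [Pi.smul_apply, smul_eq_mul, mul_sub, Finset.mul_sum]
      congr 1 <;> exact Finset.sum_congr rfl fun _ _ => by ring)

theorem sympForm_apply (v w : ι ⊕ ι → K) : sympForm K ι v w =
    ∑ i, v (Sum.inl i) * w (Sum.inr i) - ∑ i, w (Sum.inl i) * v (Sum.inr i) := rfl

theorem symp_eq_trace (v w : ι ⊕ ι → K) :
    symp p v w = Algebra.trace (ZMod p) K (sympForm K ι v w) := by
  rw [sympForm_apply, map_sub, symp]

theorem sympForm_isAlt : (sympForm K ι).IsAlt := fun v => by simp [sympForm_apply]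

theorem sympForm_nondegenerate : (sympForm K ι).Nondegenerate := by
  classical
  have hrefl : (sympForm K ι).IsRefl := sympForm_isAlt.isRefl
  refine (LinearMap.IsRefl.nondegenerate_iff_separatingLeft hrefl).2 fun v hv => ?_
  ext (i | i)
  · simpa [sympForm_apply, Pi.single_apply] using hv (Pi.single (Sum.inr i) 1)
  · simpa [sympForm_apply, Pi.single_apply] using hv (Pi.single (Sum.inl i) 1)

/-- Scaling by `𝔽_q` makes trace orthogonality to a subspace equivalent to orthogonality for the
`𝔽_q`-valued form, so dimension counts over `𝔽_q` apply. -/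
theorem exists_symp_smul_ne_zero [Finite K] {v w : ι ⊕ ι → K} (h : sympForm K ι v w ≠ 0) :
    ∃ t : K, symp p v (t • w) ≠ 0 := by
  simp_rw [symp_eq_trace, map_smul, smul_eq_mul]
  exact exists_trace_mul_ne_zero p h

/-- A vector outside a subspace is detected by a vector orthogonal to the subspace. -/
theorem exists_symp_ne_zero_of_notMem [Finite K] (S : Submodule K (ι ⊕ ι → K)) {d : ι ⊕ ι → K}
    (hd : d ∉ S) : ∃ v, (∀ s ∈ S, symp p s v = 0) ∧ symp p d v ≠ 0 := by
  have hrefl : (sympForm K ι).IsRefl := sympForm_isAlt.isRefl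
  -- Nondegeneracy gives `S = S^⊥⊥`, so `d` fails to be orthogonal to some `v ∈ S^⊥`.
  rw [← LinearMap.BilinForm.orthogonal_orthogonal sympForm_nondegenerate hrefl S,
    LinearMap.BilinForm.mem_orthogonal_iff] at hd
  push Not at hd
  obtain ⟨v, hv, hvd⟩ := hd
  rw [LinearMap.BilinForm.mem_orthogonal_iff] at hv
  obtain ⟨t, ht⟩ := exists_symp_smul_ne_zero p fun h => hvd (hrefl _ _ h)
  refine ⟨t • v, fun s hs => ?_, ht⟩
  rw [symp_eq_trace, map_smul, hv s hs, smul_zero, map_zero]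

/-- The column space of a self-column-orthogonal matrix of full rank is its own orthogonal
complement. -/
theorem SelfColumnOrthogonal.exists_mulVec_eq [Finite K] {κ : Type*} [Fintype κ]
    {G : Matrix (ι ⊕ ι) κ K} (hG : SelfColumnOrthogonal p G) (hind : LinearIndependent K G.col)
    (hcard : Fintype.card κ = Fintype.card ι) {v : ι ⊕ ι → K}
    (hv : ∀ y, symp p (G *ᵥ y) v = 0) : ∃ y, G *ᵥ y = v := by
  set N := G.mulVecLin.range with hN
  have hNle : N ≤ (sympForm K ι).orthogonal N := by
    rintro _ ⟨y, rfl⟩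
    rw [LinearMap.BilinForm.mem_orthogonal_iff]
    rintro _ ⟨y', rfl⟩
    by_contra hne
    obtain ⟨t, ht⟩ := exists_symp_smul_ne_zero p hne
    refine ht ?_
    simpa [Matrix.mulVec_smul] using hG y' (t • y)
  have hrank : Module.finrank K N = Fintype.card ι := by
    rw [hN, Matrix.range_mulVecLin, finrank_span_eq_card hind, hcard]
  -- An isotropic subspace of dimension `n` in dimension `2n` equals its complement, which also has
  -- dimension `2n - n`.
  have heq : N = (sympForm K ι).orthogonal N := by
    refine Submodule.eq_of_le_of_finrank_eq hNle ?_
    rw [LinearMap.BilinForm.finrank_orthogonal sympForm_nondegenerate, hrank]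
    simp
  have : v ∈ N := by
    rw [heq, LinearMap.BilinForm.mem_orthogonal_iff]
    rintro _ ⟨y, rfl⟩
    by_contra hne
    obtain ⟨t, ht⟩ := exists_trace_mul_ne_zero p hne
    refine ht ?_
    have := hv (t • y)
    rwa [symp_eq_trace, Matrix.mulVec_smul, LinearMap.map_smul₂] at this
  exact this

end Symplectic

/-! ### Existence of stabilizer states. -/

section CommonEigenvector

/-- A commuting family of endomorphisms has a common eigenvector. -/
theorem exists_common_eigenvector {k V α : Type*} [Field k] [IsAlgClosed k] [AddCommGroup V]
    [Module k V] [FiniteDimensional k V] [Nontrivial V] (f : α → Module.End k V)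
    (hf : ∀ a b, Commute (f a) (f b)) : ∃ v ≠ 0, ∀ a, ∃ c : k, f a v = c • v := by
  -- Take a minimal nonzero subspace `U` invariant under the whole family. Each `f a` has an
  -- eigenvalue on `U`; by commutation that eigenspace meets `U` in an invariant subspace, hence
  -- contains `U`.
  let P : Submodule k V → Prop := fun U => U ≠ ⊥ ∧ ∀ a, ∀ v ∈ U, f a v ∈ U
  obtain ⟨U, ⟨hU, hinv⟩, hmin⟩ :=
    (wellFounded_lt (α := Submodule k V)).has_min {U | P U} ⟨⊤, top_ne_bot, by simp⟩
  obtain ⟨v, hvU, hv⟩ := U.exists_mem_ne_zero_of_ne_bot hU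
  refine ⟨v, hv, fun a => ?_⟩
  have : Nontrivial U := ⟨⟨v, hvU⟩, 0, by simpa using hv⟩
  obtain ⟨c, hc⟩ := Module.End.exists_eigenvalue ((f a).restrict (hinv a))
  obtain ⟨w, hw⟩ := hc.exists_hasEigenvector
  have hwc : f a w = c • (w : V) := congrArg Subtype.val hw.apply_eq_smul
  have hP : P (U ⊓ (f a).eigenspace c) := by
    refine ⟨fun hbot => hw.2 ?_, fun b x hx => ⟨hinv b x hx.1, ?_⟩⟩
    · have : (w : V) ∈ U ⊓ (f a).eigenspace c :=
        ⟨w.2, Module.End.mem_eigenspace_iff.2 hwc⟩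
      rw [hbot, Submodule.mem_bot] at this
      exact Subtype.ext this
    · have hx2 := Module.End.mem_eigenspace_iff.1 hx.2
      refine Module.End.mem_eigenspace_iff.2 ?_
      rw [← Module.End.mul_apply, (hf a b).eq, Module.End.mul_apply, hx2, map_smul]
  have hle : U ≤ (f a).eigenspace c := by
    have := hmin _ hP
    rw [lt_iff_le_not_ge, not_and, not_not] at this
    exact (this inf_le_left).trans inf_le_right
  exact ⟨c, Module.End.mem_eigenspace_iff.1 (hle hvU)⟩

theorem SelfColumnOrthogonal.exists_isStabilizerState (p : ℕ) [Fact p.Prime] {K : Type*} [Field K]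
    [Fintype K] [DecidableEq K] [Algebra (ZMod p) K] {ι κ : Type*} [Fintype ι] [DecidableEq ι]
    [Fintype κ] {G : Matrix (ι ⊕ ι) κ K} (hG : SelfColumnOrthogonal p G) :
    ∃ ψ, IsStabilizerState p G ψ := by
  obtain ⟨φ, hφ, hev⟩ := exists_common_eigenvector
    (fun y : κ → K => (weyl p (G *ᵥ y)).toLin') fun y y' => by
      rw [commute_iff_eq, Module.End.mul_eq_comp, Module.End.mul_eq_comp, ← Matrix.toLin'_mul,
        ← Matrix.toLin'_mul, weyl_comm, hG, AddChar.map_zero_eq_one, one_smul]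
  have hpos : 0 < star φ ⬝ᵥ φ := Matrix.dotProduct_star_self_pos_iff.2 hφ
  set r : ℝ := (star φ ⬝ᵥ φ).re with hr
  have hrpos : 0 < r := (Complex.pos_iff.1 hpos).1
  have hreq : star φ ⬝ᵥ φ = (r : ℂ) := (Complex.eq_re_of_ofReal_le hpos.le)
  refine ⟨((Real.sqrt r : ℂ)⁻¹) • φ, ?_, fun y => ?_⟩
  · have h2 : (Real.sqrt r : ℂ) * Real.sqrt r = r := by
      rw [← Complex.ofReal_mul, Real.mul_self_sqrt hrpos.le]
    have h3 : (Real.sqrt r : ℂ) ≠ 0 := by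
      exact_mod_cast (Real.sqrt_pos.2 hrpos).ne'
    simp only [star_smul, smul_dotProduct, dotProduct_smul, hreq, smul_eq_mul, ← h2]
    simp
    field_simp
  · obtain ⟨c, hc⟩ := hev y
    refine ⟨c, ?_⟩
    rw [Matrix.mulVec_smul, ← Matrix.toLin'_apply, hc, smul_comm]

end CommonEigenvector

/-! ### Partial traces and reduced states. -/

section PartialTrace

variable {X Y : Type*} [Fintype Y]

/-- The partial trace over the second tensor factor. -/
def partialTrace (M : Matrix (X × Y) (X × Y) ℂ) : Matrix X X ℂ :=
  fun x y => ∑ z, M (x, z) (y, z)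

variable [Fintype X]

theorem trace_partialTrace (M : Matrix (X × Y) (X × Y) ℂ) : (partialTrace M).trace = M.trace := by
  simp [Matrix.trace, partialTrace, Fintype.sum_prod_type]

/-- Cyclicity of the trace, for operators acting only on the factor that is traced out. -/
theorem partialTrace_one_kronecker_mul_comm [DecidableEq X] (Q : Matrix Y Y ℂ)
    (M : Matrix (X × Y) (X × Y) ℂ) :
    partialTrace ((1 : Matrix X X ℂ) ⊗ₖ Q * M) = partialTrace (M * (1 : Matrix X X ℂ) ⊗ₖ Q) := by
  ext x y
  have h1 (z : Y) : ((1 : Matrix X X ℂ) ⊗ₖ Q * M) (x, z) (y, z) =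
      ∑ w, Q z w * M (x, w) (y, z) := by
    simp [Matrix.mul_apply, Fintype.sum_prod_type_right, Matrix.one_apply]
  have h2 (z : Y) : (M * (1 : Matrix X X ℂ) ⊗ₖ Q) (x, z) (y, z) =
      ∑ w, Q w z * M (x, z) (y, w) := by
    simp [Matrix.mul_apply, Fintype.sum_prod_type_right, Matrix.one_apply, mul_comm]
  simp only [partialTrace, h1, h2]
  exact Finset.sum_comm

variable [DecidableEq Y]

theorem partialTrace_kronecker_one_mul (P : Matrix X X ℂ) (M : Matrix (X × Y) (X × Y) ℂ) :
    partialTrace (P ⊗ₖ (1 : Matrix Y Y ℂ) * M) = P * partialTrace M := by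
  ext x y
  simp only [partialTrace, Matrix.mul_apply, Fintype.sum_prod_type, Matrix.kroneckerMap_apply,
    Matrix.one_apply, mul_ite, mul_one, mul_zero, ite_mul, zero_mul, Finset.sum_ite_eq,
    Finset.mem_univ, if_true, Finset.mul_sum]
  exact Finset.sum_comm

theorem partialTrace_mul_kronecker_one (P : Matrix X X ℂ) (M : Matrix (X × Y) (X × Y) ℂ) :
    partialTrace (M * P ⊗ₖ (1 : Matrix Y Y ℂ)) = partialTrace M * P := by
  ext x y
  simp only [partialTrace, Matrix.mul_apply, Fintype.sum_prod_type, Matrix.kroneckerMap_apply,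
    Matrix.one_apply, mul_ite, mul_one, mul_zero, Finset.sum_ite_eq',
    Finset.mem_univ, if_true, Finset.sum_mul]
  exact Finset.sum_comm

theorem partialTrace_kronecker_conj [DecidableEq X] (P : Matrix X X ℂ) {Q : Matrix Y Y ℂ}
    (hQ : Qᴴ * Q = 1) (M : Matrix (X × Y) (X × Y) ℂ) :
    partialTrace (P ⊗ₖ Q * M * (P ⊗ₖ Q)ᴴ) = P * partialTrace M * Pᴴ := by
  have h : P ⊗ₖ Q = P ⊗ₖ (1 : Matrix Y Y ℂ) * (1 : Matrix X X ℂ) ⊗ₖ Q := by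
    rw [← Matrix.mul_kronecker_mul, one_mul, mul_one]
  rw [h, Matrix.conjTranspose_mul, Matrix.conjTranspose_kronecker, Matrix.conjTranspose_kronecker,
    Matrix.conjTranspose_one, Matrix.conjTranspose_one, ← mul_assoc, mul_assoc, mul_assoc,
    mul_assoc, partialTrace_kronecker_one_mul, ← mul_assoc, ← mul_assoc,
    partialTrace_mul_kronecker_one, mul_assoc _ M, partialTrace_one_kronecker_mul_comm, mul_assoc M,
    ← Matrix.mul_kronecker_mul, hQ, one_mul, Matrix.one_kronecker_one, mul_one, mul_assoc]

end PartialTrace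

/-- Transports statements about `reduced` to statements about `partialTrace` on a genuine product.
-/
theorem exists_eq_reindex_splitEquiv {ι S : Type*} [DecidableEq ι] (A : Finset ι)
    (ρ : Matrix (ι → S) (ι → S) ℂ) :
    ∃ M, ρ = Matrix.reindex (splitEquiv S A).symm (splitEquiv S A).symm M :=
  ⟨Matrix.reindex (splitEquiv S A) (splitEquiv S A) ρ, by ext; simp⟩

section Reduced

variable {ι S : Type*} [Fintype ι] [DecidableEq ι] [Fintype S] (A : Finset ι)

theorem reduced_reindex
    (M : Matrix (({i // i ∈ A} → S) × ({i // i ∉ A} → S))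
      (({i // i ∈ A} → S) × ({i // i ∉ A} → S)) ℂ) :
    reduced A (Matrix.reindex (splitEquiv S A).symm (splitEquiv S A).symm M) = partialTrace M := by
  ext x y
  simp [reduced, partialTrace]

theorem reduced_smul (c : ℂ) (ρ : Matrix (ι → S) (ι → S) ℂ) :
    reduced A (c • ρ) = c • reduced A ρ := by
  ext x y
  simp [reduced, Finset.mul_sum]

theorem reduced_sum {α : Type*} (s : Finset α) (ρ : α → Matrix (ι → S) (ι → S) ℂ) :
    reduced A (∑ a ∈ s, ρ a) = ∑ a ∈ s, reduced A (ρ a) := by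
  ext x y
  simp only [reduced, Matrix.sum_apply]
  exact Finset.sum_comm

/-- The reduced operator is a sum of principal submatrices, one for each basis label of the
discarded shares. -/
theorem posSemidef_reduced {ρ : Matrix (ι → S) (ι → S) ℂ} (hρ : ρ.PosSemidef) :
    (reduced A ρ).PosSemidef := by
  have : reduced A ρ = ∑ z : {i // i ∉ A} → S,
      ρ.submatrix (fun x => (splitEquiv S A).symm (x, z)) fun x => (splitEquiv S A).symm (x, z) := by
    ext x y
    simp [reduced, Matrix.sum_apply]
  rw [this]
  exact Matrix.posSemidef_sum _ fun z _ => hρ.submatrix _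

theorem trace_reduced (ρ : Matrix (ι → S) (ι → S) ℂ) : (reduced A ρ).trace = ρ.trace := by
  obtain ⟨M, rfl⟩ := exists_eq_reindex_splitEquiv A ρ
  rw [reduced_reindex, trace_partialTrace]
  exact ((splitEquiv S A).sum_comp fun x => M x x).symm

variable [DecidableEq S]

theorem reduced_mul_extendOp (ρ : Matrix (ι → S) (ι → S) ℂ)
    (P : Matrix ({i // i ∈ A} → S) ({i // i ∈ A} → S) ℂ) :
    reduced A (ρ * extendOp A P) = reduced A ρ * P := by
  obtain ⟨M, rfl⟩ := exists_eq_reindex_splitEquiv A ρ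
  rw [extendOp, reduced_reindex, ← partialTrace_mul_kronecker_one, ← reduced_reindex]
  simp only [Matrix.reindex_apply, Matrix.submatrix_mul_equiv]

theorem reduced_extendOp_mul (ρ : Matrix (ι → S) (ι → S) ℂ)
    (P : Matrix ({i // i ∈ A} → S) ({i // i ∈ A} → S) ℂ) :
    reduced A (extendOp A P * ρ) = P * reduced A ρ := by
  obtain ⟨M, rfl⟩ := exists_eq_reindex_splitEquiv A ρ
  rw [extendOp, reduced_reindex, ← partialTrace_kronecker_one_mul, ← reduced_reindex]
  simp only [Matrix.reindex_apply, Matrix.submatrix_mul_equiv]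

theorem trace_mul_extendOp (ρ : Matrix (ι → S) (ι → S) ℂ)
    (P : Matrix ({i // i ∈ A} → S) ({i // i ∈ A} → S) ℂ) :
    (ρ * extendOp A P).trace = (reduced A ρ * P).trace := by
  rw [← reduced_mul_extendOp, trace_reduced]

end Reduced

/-! ### Positivity and pure states. -/

section PosSemidef

variable {X : Type*} [Fintype X]

open scoped MatrixOrder in
-- With `P = B* B`, cyclicity turns the trace into that of the positive semidefinite matrix `B Q
-- B*`.
theorem trace_mul_nonneg_of_posSemidef {P Q : Matrix X X ℂ} (hP : P.PosSemidef)
    (hQ : Q.PosSemidef) : 0 ≤ (P * Q).trace := by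
  classical
  obtain ⟨B, rfl⟩ := CStarAlgebra.nonneg_iff_eq_star_mul_self.1 hP.nonneg
  rw [Matrix.star_eq_conjTranspose, mul_assoc, Matrix.trace_mul_comm]
  exact (hQ.mul_mul_conjTranspose_same B).trace_nonneg

theorem posSemidef_pureState (ψ : X → ℂ) : (pureState ψ).PosSemidef :=
  Matrix.posSemidef_vecMulVec_self_star ψ

theorem trace_pureState (ψ : X → ℂ) : (pureState ψ).trace = star ψ ⬝ᵥ ψ := by
  rw [pureState, Matrix.trace_vecMulVec, dotProduct_comm]

theorem mul_pureState {W : Matrix X X ℂ} {ψ : X → ℂ} {c : ℂ} (h : W *ᵥ ψ = c • ψ) :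
    W * pureState ψ = c • pureState ψ := by
  rw [pureState, Matrix.mul_vecMulVec, h, Matrix.smul_vecMulVec]

/-- An eigenvalue of an isometry at a unit vector has modulus one. -/
theorem star_mul_self_of_mulVec_eq_smul [DecidableEq X] {W : Matrix X X ℂ} (hW : Wᴴ * W = 1)
    {ψ : X → ℂ} (hψ : star ψ ⬝ᵥ ψ = 1) {c : ℂ} (h : W *ᵥ ψ = c • ψ) : star c * c = 1 := by
  have h1 : star (W *ᵥ ψ) ⬝ᵥ (W *ᵥ ψ) = 1 := by
    rw [Matrix.star_mulVec, ← Matrix.dotProduct_mulVec, Matrix.mulVec_mulVec, hW,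
      Matrix.one_mulVec, hψ]
  rwa [h, star_smul, smul_dotProduct, dotProduct_smul, hψ, smul_eq_mul, smul_eq_mul,
    mul_one] at h1

end PosSemidef

/-! ### Weyl operators on a subset of the shares. -/

section WeylRestriction

variable (p : ℕ) [Fact p.Prime] {K : Type*} [Field K] [Algebra (ZMod p) K] {ι : Type*}

/-- The restriction of a vector of `𝔽_q^{2|ι|}` to the coordinates of the parties in `A`. -/
def restr (A : Finset ι) : (ι ⊕ ι → K) →ₗ[K] ({i // i ∈ A} ⊕ {i // i ∈ A} → K) :=
  LinearMap.funLeft K K (Sum.map Subtype.val Subtype.val)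

/-- The extension by zero of a vector on the coordinates of the parties in `A`. -/
def extendZero [DecidableEq ι] (A : Finset ι) (v : {i // i ∈ A} ⊕ {i // i ∈ A} → K) : ι ⊕ ι → K :=
  Sum.elim (fun i => if h : i ∈ A then v (Sum.inl ⟨i, h⟩) else 0)
    fun i => if h : i ∈ A then v (Sum.inr ⟨i, h⟩) else 0

theorem restr_inl (A : Finset ι) (w : ι ⊕ ι → K) (i : {i // i ∈ A}) :
    restr A w (Sum.inl i) = w (Sum.inl i) := rfl

theorem restr_inr (A : Finset ι) (w : ι ⊕ ι → K) (i : {i // i ∈ A}) :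
    restr A w (Sum.inr i) = w (Sum.inr i) := rfl

variable [DecidableEq ι]

theorem restr_extendZero (A : Finset ι) (v : {i // i ∈ A} ⊕ {i // i ∈ A} → K) :
    restr A (extendZero A v) = v := by
  ext (i | i)
  · simp [restr_inl, extendZero]
  · simp [restr_inr, extendZero]

variable [Fintype ι]

/-- Extension by zero is the symplectic adjoint of restriction; this links orthogonality on `A` to
orthogonality on all shares. -/
theorem symp_extendZero (A : Finset ι) (w : ι ⊕ ι → K) (v : {i // i ∈ A} ⊕ {i // i ∈ A} → K) :
    symp p w (extendZero A v) = symp p (restr A w) v := by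
  have h (f : ι → K) (hf : ∀ i ∉ A, f i = 0) : ∑ i, f i = ∑ i : {i // i ∈ A}, f i := by
    rw [Finset.sum_coe_sort, Finset.sum_subset (Finset.subset_univ A) fun i _ => hf i]
  rw [symp, symp, h, h]
  · simp [restr_inl, restr_inr, extendZero]
  · intro i hi
    simp [extendZero, hi]
  · intro i hi
    simp [extendZero, hi]

variable [Fintype K] [DecidableEq K]

theorem weyl_eq_reindex_kronecker (A : Finset ι) (w : ι ⊕ ι → K) :
    weyl p w = Matrix.reindex (splitEquiv K A).symm (splitEquiv K A).symm
      (weyl p (restr A w) ⊗ₖ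
        weyl p (w ∘ Sum.map Subtype.val Subtype.val : {i // i ∉ A} ⊕ {i // i ∉ A} → K)) := by
  ext x y
  simp only [Matrix.reindex_apply, Matrix.submatrix_apply, Matrix.kroneckerMap_apply, weyl]
  rw [← Fintype.prod_subtype_mul_prod_subtype (fun i => i ∈ A)]
  exact congrArg₂ (· * ·) (Finset.prod_congr (by ext; simp) fun _ _ => rfl) rfl

theorem weyl_extendZero (A : Finset ι) (v : {i // i ∈ A} ⊕ {i // i ∈ A} → K) :
    weyl p (extendZero A v) = extendOp A (weyl p v) := by
  have h : (extendZero A v ∘ Sum.map Subtype.val Subtype.val :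
      {i // i ∉ A} ⊕ {i // i ∉ A} → K) = 0 := by
    ext (i | i) <;> simp [extendZero, i.2]
  rw [weyl_eq_reindex_kronecker p A, restr_extendZero, h, weyl_zero, extendOp]

/-- `W(w)` factors across the cut, and its unitary factor on the discarded shares cancels under the
partial trace. -/
theorem reduced_weyl_conj (A : Finset ι) (w : ι ⊕ ι → K) (ρ : Matrix (ι → K) (ι → K) ℂ) :
    reduced A (weyl p w * ρ * (weyl p w)ᴴ) =
      weyl p (restr A w) * reduced A ρ * (weyl p (restr A w))ᴴ := by
  obtain ⟨M, rfl⟩ := exists_eq_reindex_splitEquiv A ρ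
  rw [reduced_reindex, ← partialTrace_kronecker_conj _ (weyl_conjTranspose_mul_self p
    (w ∘ Sum.map Subtype.val Subtype.val : {i // i ∉ A} ⊕ {i // i ∉ A} → K)),
    ← reduced_reindex, weyl_eq_reindex_kronecker p A w]
  simp only [Matrix.reindex_apply, Matrix.submatrix_mul_equiv, Matrix.conjTranspose_submatrix]

/-- The scalar in `weyl_mul_weyl` has modulus one and cancels: conjugation is a true action of the
additive group. -/
theorem weyl_conj_add (v w : ι ⊕ ι → K) (σ : Matrix (ι → K) (ι → K) ℂ) :
    weyl p (v + w) * σ * (weyl p (v + w))ᴴ =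
      weyl p v * (weyl p w * σ * (weyl p w)ᴴ) * (weyl p v)ᴴ := by
  have h : weyl p v * (weyl p w * σ * (weyl p w)ᴴ) * (weyl p v)ᴴ =
      (weyl p v * weyl p w) * σ * (weyl p v * weyl p w)ᴴ := by
    simp only [Matrix.conjTranspose_mul, mul_assoc]
  rw [h, weyl_mul_weyl, Matrix.conjTranspose_smul, smul_mul_assoc, smul_mul_assoc,
    mul_smul_comm, smul_smul, star_traceChar, traceChar_mul_neg, one_smul]

theorem trace_weyl_conj (w : ι ⊕ ι → K) (σ : Matrix (ι → K) (ι → K) ℂ) :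
    (weyl p w * σ * (weyl p w)ᴴ).trace = σ.trace := by
  rw [Matrix.trace_mul_comm, ← mul_assoc, weyl_conjTranspose_mul_self, one_mul]

theorem weyl_mul_weyl_conj {v : ι ⊕ ι → K} (w : ι ⊕ ι → K) {σ : Matrix (ι → K) (ι → K) ℂ} {c : ℂ}
    (h : weyl p v * σ = c • σ) : weyl p v * (weyl p w * σ * (weyl p w)ᴴ) =
      (ZMod.stdAddChar (symp p w v) * c) • (weyl p w * σ * (weyl p w)ᴴ) := by
  rw [← mul_assoc, ← mul_assoc, weyl_comm, smul_mul_assoc, mul_assoc (weyl p w), h, mul_smul_comm,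
    smul_smul, smul_mul_assoc]

/-- A state fixed by `W(v)` up to a phase is orthogonal to its translates by vectors `d` that are
not orthogonal to `v`. -/
theorem mul_weyl_conj_eq_zero {v d : ι ⊕ ι → K} {σ : Matrix (ι → K) (ι → K) ℂ}
    (hσ : σ.IsHermitian) {c : ℂ} (hc : star c * c = 1) (h : weyl p v * σ = c • σ)
    (hd : symp p d v ≠ 0) : σ * (weyl p d * σ * (weyl p d)ᴴ) = 0 := by
  set τ := weyl p d * σ * (weyl p d)ᴴ with hτ
  -- `W(v)ᴴ W(v) = 1` is inserted in `σ τ`. Absorbing one factor on each side multiplies `σ τ` by a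
  -- phase other than `1`.
  have h1 : (weyl p v * σ)ᴴ * (weyl p v * τ) = σ * τ := by
    rw [Matrix.conjTranspose_mul, mul_assoc, ← mul_assoc _ (weyl p v),
      weyl_conjTranspose_mul_self, one_mul, hσ.eq]
  rw [hτ, weyl_mul_weyl_conj p d h, ← hτ, h, Matrix.conjTranspose_smul, hσ.eq, smul_mul_smul_comm,
    mul_left_comm, hc, mul_one] at h1
  have h2 : (ZMod.stdAddChar (symp p d v) - 1 : ℂ) • (σ * τ) = 0 := by
    rw [sub_smul, h1, one_smul, sub_self]
  exact (smul_eq_zero.1 h2).resolve_left (sub_ne_zero.2 (stdAddChar_ne_one p hd))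

end WeylRestriction

/-! ### Classical secret sharing and span programs as linear algebra. -/

section Classical

variable {K : Type*} [Field K] {ι κ μ : Type*} [Fintype κ] [Fintype μ]

/-- The projection to the coordinates in `C`, as a linear map. -/
def projLinear (K : Type*) [Field K] (C : Finset ι) : (ι → K) →ₗ[K] ({i // i ∈ C} → K) :=
  LinearMap.funLeft K K Subtype.val

theorem coe_projLinear (C : Finset ι) : ⇑(projLinear K C) = proj C := rfl

/-- The coordinates selected by `R` of `F m + G u` determine `m`. -/
def Determines {Z : Type*} [AddCommGroup Z] [Module K Z] (R : (ι → K) →ₗ[K] Z)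
    (G : Matrix ι κ K) (F : Matrix ι μ K) : Prop :=
  ∀ m y, R (F *ᵥ m) = R (G *ᵥ y) → m = 0

/-- The coordinates selected by `R` of `F m` are masked by those of `G u`. -/
def Masks {Z : Type*} [AddCommGroup Z] [Module K Z] (R : (ι → K) →ₗ[K] Z)
    (G : Matrix ι κ K) (F : Matrix ι μ K) : Prop :=
  ∀ m, ∃ y, R (F *ᵥ m) = R (G *ᵥ y)

theorem Determines.exists_decoder {Z : Type*} [AddCommGroup Z] [Module K Z]
    {R : (ι → K) →ₗ[K] Z} {G : Matrix ι κ K} {F : Matrix ι μ K} (h : Determines R G F) :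
    ∃ dec : Z → (μ → K), ∀ m u, dec (R (F *ᵥ m + G *ᵥ u)) = m := by
  let f : (μ → K) × (κ → K) → Z := fun x => R (F *ᵥ x.1 + G *ᵥ x.2)
  have hf : Function.FactorsThrough Prod.fst f := fun x y hxy => by
    refine sub_eq_zero.1 (h (x.1 - y.1) (y.2 - x.2) ?_)
    simp only [f, map_add] at hxy
    rw [Matrix.mulVec_sub, Matrix.mulVec_sub, map_sub, map_sub, sub_eq_sub_iff_add_eq_add, hxy,
      add_comm]
  -- Outside the possible share vectors the decoder takes the irrelevant value `0`.
  exact ⟨Function.extend f Prod.fst 0, fun m u => hf.extend_apply 0 (m, u)⟩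

theorem mem_imProj (C : Finset ι) (G : Matrix ι κ K) (z : {i // i ∈ C} → K) :
    z ∈ imProj C G ↔ ∃ y, proj C (G *ᵥ y) = z := by
  have : imProj C G = (G.submatrix (Subtype.val : {i // i ∈ C} → ι) id).mulVecLin.range := by
    rw [Matrix.range_mulVecLin]
    rfl
  rw [this, LinearMap.mem_range]
  rfl

theorem sum_smul_proj_col (C : Finset ι) (F : Matrix ι μ K) (m : μ → K) :
    ∑ j, m j • proj C (F.col j) = proj C (F *ᵥ m) := by
  ext i
  simp [proj, Matrix.mulVec, dotProduct, mul_comm]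

theorem linearIndependent_mkQ_proj_col_iff (C : Finset ι) (G : Matrix ι κ K) (F : Matrix ι μ K) :
    LinearIndependent K (fun j => (imProj C G).mkQ (proj C (F.col j))) ↔
      Determines (projLinear K C) G F := by
  rw [Fintype.linearIndependent_iff]
  have h (m : μ → K) : ∑ j, m j • (imProj C G).mkQ (proj C (F.col j)) = 0 ↔
      ∃ y, proj C (G *ᵥ y) = proj C (F *ᵥ m) := by
    simp_rw [← map_smul, ← map_sum, sum_smul_proj_col, Submodule.mkQ_apply,
      Submodule.Quotient.mk_eq_zero, mem_imProj]
  simp only [h]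
  exact ⟨fun H m y hy => funext (H m ⟨y, hy.symm⟩),
    fun H m ⟨y, hy⟩ => congrFun (H m y hy.symm)⟩

theorem forall_proj_col_mem_imProj_iff (C : Finset ι) (G : Matrix ι κ K) (F : Matrix ι μ K) :
    (∀ j, proj C (F.col j) ∈ imProj C G) ↔ Masks (projLinear K C) G F := by
  classical
  refine ⟨fun h m => ?_, fun h j => ?_⟩
  · have : proj C (F *ᵥ m) ∈ imProj C G := by
      rw [← sum_smul_proj_col]
      exact Submodule.sum_mem _ fun j _ => Submodule.smul_mem _ _ (h j)
    obtain ⟨y, hy⟩ := (mem_imProj C G _).1 this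
    exact ⟨y, hy.symm⟩
  · obtain ⟨y, hy⟩ := h (Pi.single j 1)
    refine (mem_imProj C G _).2 ⟨y, ?_⟩
    rw [Matrix.mulVec_single_one] at hy
    exact hy.symm

theorem isMMSP_iff (G : Matrix ι κ K) (F : Matrix ι μ K) (𝔄 𝔅 : Set (Finset ι)) :
    IsMMSP G F 𝔄 𝔅 ↔ (∀ C ∈ 𝔄, Determines (projLinear K C) G F) ∧
      ∀ C ∈ 𝔅, Masks (projLinear K C) G F := by
  simp only [IsMMSP, linearIndependent_mkQ_proj_col_iff, forall_proj_col_mem_imProj_iff]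

/-- The two maps have different codomains, but `Determines` and `Masks` only use which vectors they
identify. -/
theorem projLinear_disjSum_eq_iff (A : Finset ι) (z z' : ι ⊕ ι → K) :
    projLinear K (A.disjSum A) z = projLinear K (A.disjSum A) z' ↔ restr A z = restr A z' := by
  simp only [funext_iff, coe_projLinear, proj, Subtype.forall, Finset.mem_disjSum, Sum.forall,
    restr_inl, restr_inr]
  simp

theorem determines_projLinear_disjSum_iff (A : Finset ι) (G : Matrix (ι ⊕ ι) κ K)
    (F : Matrix (ι ⊕ ι) μ K) :
    Determines (projLinear K (A.disjSum A)) G F ↔ Determines (restr A) G F := by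
  simp only [Determines, projLinear_disjSum_eq_iff]

theorem masks_projLinear_disjSum_iff (A : Finset ι) (G : Matrix (ι ⊕ ι) κ K)
    (F : Matrix (ι ⊕ ι) μ K) :
    Masks (projLinear K (A.disjSum A)) G F ↔ Masks (restr A) G F := by
  simp only [Masks, projLinear_disjSum_eq_iff]

variable [Fintype K] [DecidableEq κ]

theorem map_shareLaw {Z : Type*} (G : Matrix ι κ K) (F : Matrix ι μ K) (m : μ → K)
    (f : (ι → K) → Z) : (shareLaw G F m).map f =
      (PMF.uniformOfFintype (κ → K)).map fun u => f (F *ᵥ m + G *ᵥ u) :=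
  PMF.map_comp _ _ _

theorem exists_classical_decoder_iff (C : Finset ι) (G : Matrix ι κ K) (F : Matrix ι μ K) :
    (∃ dec : ({i // i ∈ C} → K) → (μ → K),
      ∀ m, ((shareLaw G F m).map fun z => dec (proj C z)) = PMF.pure m) ↔
      Determines (projLinear K C) G F := by
  simp_rw [map_shareLaw]
  constructor
  · rintro ⟨dec, hdec⟩ m y hy
    -- The uniform law has full support, so decoding with probability one is decoding for every `u`.
    have key (m : μ → K) (u : κ → K) : dec (proj C (F *ᵥ m + G *ᵥ u)) = m := by
      have h1 : dec (proj C (F *ᵥ m + G *ᵥ u)) ∈ (PMF.pure m).support := by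
        rw [← hdec m, PMF.support_map]
        exact ⟨u, PMF.mem_support_uniformOfFintype u, rfl⟩
      simpa using h1
    rw [← key m 0, ← key 0 y]
    simp only [Matrix.mulVec_zero, add_zero, zero_add]
    exact congrArg dec hy
  · intro h
    obtain ⟨dec, hdec⟩ := h.exists_decoder
    refine ⟨dec, fun m => ?_⟩
    simp_rw [← coe_projLinear, hdec]
    exact PMF.map_const _ _

theorem uniformOfFintype_map_equiv {α : Type*} [Fintype α] [Nonempty α] (e : α ≃ α) :
    (PMF.uniformOfFintype α).map e = PMF.uniformOfFintype α := by
  ext a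
  rw [PMF.map_apply, tsum_eq_single (e.symm a)]
  · simp
  · intro b hb
    rw [if_neg]
    rintro rfl
    simp at hb

theorem map_proj_shareLaw_eq_iff (C : Finset ι) (G : Matrix ι κ K) (F : Matrix ι μ K) :
    (∀ m m', (shareLaw G F m).map (proj C) = (shareLaw G F m').map (proj C)) ↔
      Masks (projLinear K C) G F := by
  simp_rw [map_shareLaw]
  constructor
  · intro h m
    -- Comparing supports suffices: a share vector of `m` must also be one of the secret `0`.
    have h1 : proj C (F *ᵥ m + G *ᵥ 0) ∈
        ((PMF.uniformOfFintype (κ → K)).map fun u => proj C (F *ᵥ 0 + G *ᵥ u)).support := by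
      rw [← h m 0, PMF.support_map]
      exact ⟨0, PMF.mem_support_uniformOfFintype _, rfl⟩
    rw [PMF.support_map] at h1
    obtain ⟨y, -, hy⟩ := h1
    refine ⟨y, ?_⟩
    rw [coe_projLinear]
    simpa using hy.symm
  · intro h
    suffices H : ∀ m, ((PMF.uniformOfFintype (κ → K)).map fun u => proj C (F *ᵥ m + G *ᵥ u)) =
        (PMF.uniformOfFintype (κ → K)).map fun u => proj C (G *ᵥ u) from
      fun m m' => (H m).trans (H m').symm
    intro m
    obtain ⟨y, hy⟩ := h m
    -- The mask `y` of `m` is absorbed by translating the uniform randomness.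
    conv_rhs => rw [← uniformOfFintype_map_equiv (Equiv.addLeft y), PMF.map_comp]
    congr 1
    ext1 u
    simp only [Function.comp_apply, Equiv.coe_addLeft, Matrix.mulVec_add, ← coe_projLinear,
      map_add, hy]

theorem linearCSSSecure_iff (G : Matrix ι κ K) (F : Matrix ι μ K) (𝔄 𝔅 : Set (Finset ι)) :
    LinearCSSSecure G F 𝔄 𝔅 ↔ (∀ C ∈ 𝔄, Determines (projLinear K C) G F) ∧
      ∀ C ∈ 𝔅, Masks (projLinear K C) G F := by
  simp only [LinearCSSSecure, exists_classical_decoder_iff, map_proj_shareLaw_eq_iff]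

end Classical

/-! ### Reduced stabilizer states and the quantum protocol. -/

section Quantum

variable {p : ℕ} [Fact p.Prime] {K : Type*} [Field K] [Fintype K] [DecidableEq K]
  [Algebra (ZMod p) K]

section Stabilizer

variable {ι κ : Type*} [Fintype ι] [DecidableEq ι] [Fintype κ] {G : Matrix (ι ⊕ ι) κ K}
  {ψ : (ι → K) → ℂ}

theorem IsStabilizerState.weyl_conj_pureState (hψ : IsStabilizerState p G ψ) (y : κ → K) :
    weyl p (G *ᵥ y) * pureState ψ * (weyl p (G *ᵥ y))ᴴ = pureState ψ := by
  obtain ⟨c, hc⟩ := hψ.2 y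
  have hcc := star_mul_self_of_mulVec_eq_smul (weyl_conjTranspose_mul_self p _) hψ.1 hc
  have h := mul_pureState hc
  have h' : pureState ψ * (weyl p (G *ᵥ y))ᴴ = star c • pureState ψ := by
    have := congrArg Matrix.conjTranspose h
    rwa [Matrix.conjTranspose_mul, Matrix.conjTranspose_smul,
      (posSemidef_pureState ψ).isHermitian.eq] at this
  rw [h, smul_mul_assoc, h', smul_smul, mul_comm, hcc, one_smul]

/-- The reduced stabilizer state is unchanged by translations in the projected column space. -/
theorem IsStabilizerState.weyl_conj_reduced (hψ : IsStabilizerState p G ψ) (A : Finset ι)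
    (y : κ → K) :
    weyl p (restr A (G *ᵥ y)) * reduced A (pureState ψ) * (weyl p (restr A (G *ᵥ y)))ᴴ =
      reduced A (pureState ψ) := by
  rw [← reduced_weyl_conj, hψ.weyl_conj_pureState]

theorem IsStabilizerState.trace_reduced_pureState (hψ : IsStabilizerState p G ψ) (A : Finset ι) :
    (reduced A (pureState ψ)).trace = 1 := by
  rw [trace_reduced, trace_pureState, hψ.1]

variable (hG : SelfColumnOrthogonal p G) (hind : LinearIndependent K G.col)
  (hcard : Fintype.card κ = Fintype.card ι) (hψ : IsStabilizerState p G ψ) (A : Finset ι)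
include hG hind hcard hψ

/-- A Weyl operator on `A` that is orthogonal to the projected column space fixes the reduced
stabilizer state up to a phase. -/
theorem exists_weyl_mul_reduced_eq_smul {v : {i // i ∈ A} ⊕ {i // i ∈ A} → K}
    (hv : ∀ y, symp p (restr A (G *ᵥ y)) v = 0) :
    ∃ c : ℂ, star c * c = 1 ∧
      weyl p v * reduced A (pureState ψ) = c • reduced A (pureState ψ) := by
  -- Maximality of `Im G` places the zero extension of `v` in it, so `ψ` is an eigenvector of `W(v)
  -- ⊗ I`.
  obtain ⟨y, hy⟩ := hG.exists_mulVec_eq p hind hcard (v := extendZero A v) fun y => by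
    rw [symp_extendZero, hv]
  obtain ⟨c, hc⟩ := hψ.2 y
  refine ⟨c, star_mul_self_of_mulVec_eq_smul (weyl_conjTranspose_mul_self p _) hψ.1 hc, ?_⟩
  rw [← reduced_extendOp_mul, ← weyl_extendZero, ← hy, mul_pureState hc, reduced_smul]

/-- Translates of the reduced stabilizer state are orthogonal unless they differ by an element of
the projected column space. -/
theorem weyl_conj_reduced_mul_weyl_conj_reduced_eq_zero
    {a b : {i // i ∈ A} ⊕ {i // i ∈ A} → K} (hab : ∀ y, b ≠ a + restr A (G *ᵥ y)) :
    weyl p a * reduced A (pureState ψ) * (weyl p a)ᴴ *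
      (weyl p b * reduced A (pureState ψ) * (weyl p b)ᴴ) = 0 := by
  obtain ⟨v, hv, hd⟩ := exists_symp_ne_zero_of_notMem p (G.mulVecLin.range.map (restr A))
    (d := b - a) (by
      rintro ⟨_, ⟨y, rfl⟩, hy⟩
      refine hab y ?_
      rw [← Matrix.mulVecLin_apply, hy, add_sub_cancel])
  obtain ⟨c, hc, hcσ⟩ := exists_weyl_mul_reduced_eq_smul hG hind hcard hψ A fun y =>
    hv _ ⟨_, ⟨y, rfl⟩, rfl⟩
  have h0 := mul_weyl_conj_eq_zero p
    (posSemidef_reduced A (posSemidef_pureState ψ)).isHermitian hc hcσ hd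
  have hb : b = a + (b - a) := (add_sub_cancel a b).symm
  -- Pulling out conjugation by `W(a)` reduces to the product of `σ` with its translate by `b - a`.
  rw [hb, weyl_conj_add]
  set τ := weyl p (b - a) * reduced A (pureState ψ) * (weyl p (b - a))ᴴ
  have : weyl p a * reduced A (pureState ψ) * (weyl p a)ᴴ * (weyl p a * τ * (weyl p a)ᴴ) =
      weyl p a * (reduced A (pureState ψ) * ((weyl p a)ᴴ * weyl p a * τ)) * (weyl p a)ᴴ := by
    simp only [mul_assoc]
  rw [this, weyl_conjTranspose_mul_self, one_mul, h0, mul_zero, zero_mul]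

end Stabilizer

section Protocol

variable {n l₂ l : ℕ} {G₁ : Matrix (Fin n ⊕ Fin n) (Fin n) K}
  {G₂ : Matrix (Fin n ⊕ Fin n) (Fin l₂) K}
  {F : Matrix (Fin n ⊕ Fin n) (Fin l) K} {ψ : (Fin n → K) → ℂ}
  {recover : (A : Finset (Fin n)) → ({i // i ∈ A} ⊕ {i // i ∈ A} → K) → (Fin l → K)}
  (A : Finset (Fin n))

theorem reduced_linearCQSS_state (m : Fin l → K) :
    reduced A ((linearCQSS p G₂ F ψ recover).state m) =
      ((Fintype.card K : ℂ) ^ l₂)⁻¹ • ∑ u : Fin l₂ → K,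
        weyl p (restr A (F *ᵥ m + G₂ *ᵥ u)) * reduced A (pureState ψ) *
          (weyl p (restr A (F *ᵥ m + G₂ *ᵥ u)))ᴴ := by
  simp only [linearCQSS, reduced_smul, reduced_sum, reduced_weyl_conj]

theorem posSemidef_reduced_linearCQSS_state (m : Fin l → K) :
    (reduced A ((linearCQSS p G₂ F ψ recover).state m)).PosSemidef := by
  rw [reduced_linearCQSS_state]
  refine (Matrix.posSemidef_sum _ fun u _ => ?_).smul (by positivity)
  exact (posSemidef_reduced A (posSemidef_pureState ψ)).mul_mul_conjTranspose_same _

variable (hψ : IsStabilizerState p G₁ ψ)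
include hψ

theorem trace_reduced_linearCQSS_state (m : Fin l → K) :
    (reduced A ((linearCQSS p G₂ F ψ recover).state m)).trace = 1 := by
  rw [reduced_linearCQSS_state, Matrix.trace_smul, Matrix.trace_sum]
  simp only [trace_weyl_conj, hψ.trace_reduced_pureState A]
  simp

/-- Secrets that differ by a masked vector give the same reduced states. -/
theorem reduced_linearCQSS_state_eq_zero {m : Fin l → K} {y : Fin n ⊕ Fin l₂ → K}
    (h : restr A (F *ᵥ m) = restr A (Matrix.fromCols G₁ G₂ *ᵥ y)) :
    reduced A ((linearCQSS p G₂ F ψ recover).state m) =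
      reduced A ((linearCQSS p G₂ F ψ recover).state 0) := by
  rw [reduced_linearCQSS_state, reduced_linearCQSS_state]
  -- The `G₂` part of the mask shifts the summation variable; the `G₁` part fixes the reduced
  -- stabilizer state.
  refine congrArg _ ((Finset.sum_congr rfl fun u _ => ?_).trans
    (Equiv.sum_comp (Equiv.addLeft (y ∘ Sum.inr)) _))
  have : restr A (F *ᵥ m + G₂ *ᵥ u) =
      restr A (F *ᵥ 0 + G₂ *ᵥ (Equiv.addLeft (y ∘ Sum.inr) u)) + restr A (G₁ *ᵥ (y ∘ Sum.inl)) := by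
    rw [map_add, h, Matrix.fromCols_mulVec]
    simp only [Equiv.coe_addLeft, Matrix.mulVec_zero, zero_add, Matrix.mulVec_add, map_add]
    abel
  rw [this, weyl_conj_add, hψ.weyl_conj_reduced]

/-- The fibres of `recover` partition the outcomes, and the twirl constant `q ^ |A|` cancels the
normalization. -/
theorem isPOVM_linearCQSS_dec : IsPOVM ((linearCQSS p G₂ F ψ recover).dec A) := by
  refine ⟨fun m => ?_, ?_⟩
  · simp only [linearCQSS]
    refine (Matrix.posSemidef_sum _ fun y _ => ?_).smul (by positivity)
    exact (posSemidef_reduced A (posSemidef_pureState ψ)).mul_mul_conjTranspose_same _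
  · simp only [linearCQSS]
    rw [← Finset.smul_sum, Finset.sum_fiberwise, sum_weyl_mul_mul_conjTranspose,
      hψ.trace_reduced_pureState A, smul_smul]
    simp

/-- Otherwise `m` and `0` have the same reduced state, on which two different outcomes would each
have probability one. -/
theorem determines_of_correct
    (hcorr : ∀ m, ((linearCQSS p G₂ F ψ recover).state m *
      extendOp A ((linearCQSS p G₂ F ψ recover).dec A m)).trace = 1) :
    Determines (restr A) (Matrix.fromCols G₁ G₂) F := by
  intro m y hy
  by_contra hm
  simp only [trace_mul_extendOp] at hcorr
  obtain ⟨hpos, hsum⟩ := isPOVM_linearCQSS_dec (recover := recover) (F := F) (G₂ := G₂) A hψ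
  have h1 := hcorr m
  have h0 := hcorr 0
  rw [reduced_linearCQSS_state_eq_zero A hψ hy] at h1
  have hτ := posSemidef_reduced_linearCQSS_state (p := p) (recover := recover) (F := F)
    (G₂ := G₂) (ψ := ψ) A 0
  have htr := trace_reduced_linearCQSS_state (recover := recover) (F := F) (G₂ := G₂) A hψ 0
  set τ := reduced A ((linearCQSS p G₂ F ψ recover).state 0)
  set Y := (linearCQSS p G₂ F ψ recover).dec A
  have hle : ∑ m' ∈ {m, 0}, (τ * Y m').trace ≤ ∑ m', (τ * Y m').trace :=
    Finset.sum_le_sum_of_subset_of_nonneg (Finset.subset_univ _) fun m' _ _ =>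
      trace_mul_nonneg_of_posSemidef hτ (hpos m')
  rw [Finset.sum_pair hm, h1, h0, ← Matrix.trace_sum, ← Finset.mul_sum, hsum, mul_one, htr] at hle
  norm_num at hle

variable (hG₁ : SelfColumnOrthogonal p G₁) (hind : LinearIndependent K G₁.col)
include hG₁ hind

/-- Outcomes outside the coset sent to `m` are annihilated by the share state, so completeness of
the POVM leaves probability one for `m`. -/
theorem correct_of_recover
    (hrec : ∀ m y, recover A (restr A (F *ᵥ m + Matrix.fromCols G₁ G₂ *ᵥ y)) = m)
    (m : Fin l → K) : ((linearCQSS p G₂ F ψ recover).state m *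
      extendOp A ((linearCQSS p G₂ F ψ recover).dec A m)).trace = 1 := by
  have hsum := (isPOVM_linearCQSS_dec (recover := recover) (F := F) (G₂ := G₂) A hψ).2
  have hzero (m' : Fin l → K) (hm' : m' ≠ m) :
      reduced A ((linearCQSS p G₂ F ψ recover).state m) *
        (linearCQSS p G₂ F ψ recover).dec A m' = 0 := by
    rw [reduced_linearCQSS_state]
    simp only [linearCQSS]
    rw [smul_mul_smul_comm, Finset.sum_mul_sum]
    refine smul_eq_zero_of_right _ (Finset.sum_eq_zero fun u _ => Finset.sum_eq_zero fun b hb => ?_)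
    refine weyl_conj_reduced_mul_weyl_conj_reduced_eq_zero hG₁ hind rfl hψ A fun y hy => hm' ?_
    refine (Finset.mem_filter.1 hb).2.symm.trans (Eq.trans ?_ (hrec m (Sum.elim y u)))
    rw [hy, ← map_add, Matrix.fromCols_mulVec, Sum.elim_comp_inl, Sum.elim_comp_inr, add_assoc,
      add_comm (G₂ *ᵥ u)]
  rw [trace_mul_extendOp, ← Finset.sum_eq_single (f := fun m' =>
    reduced A ((linearCQSS p G₂ F ψ recover).state m) *
      (linearCQSS p G₂ F ψ recover).dec A m') m (fun m' _ => hzero m')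
      fun h => absurd (Finset.mem_univ m) h,
    ← Finset.mul_sum, hsum, mul_one, trace_reduced_linearCQSS_state A hψ]

/-- An unmasked `m` is detected by a Weyl operator `W(v)`: the reduced states for `m` and `0` are
eigenoperators for different phases. -/
theorem masks_of_secret
    (hsec : ∀ m m', reduced A ((linearCQSS p G₂ F ψ recover).state m) =
      reduced A ((linearCQSS p G₂ F ψ recover).state m')) :
    Masks (restr A) (Matrix.fromCols G₁ G₂) F := by
  intro m
  by_contra! hm
  obtain ⟨v, hv, hd⟩ := exists_symp_ne_zero_of_notMem p
    ((Matrix.fromCols G₁ G₂).mulVecLin.range.map (restr A)) (d := restr A (F *ᵥ m)) (by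
      rintro ⟨_, ⟨y, rfl⟩, hy⟩
      exact hm y hy.symm)
  have hv' (y : Fin n ⊕ Fin l₂ → K) : symp p (restr A (Matrix.fromCols G₁ G₂ *ᵥ y)) v = 0 :=
    hv _ ⟨_, ⟨y, rfl⟩, rfl⟩
  have hv₁ (y : Fin n → K) : symp p (restr A (G₁ *ᵥ y)) v = 0 := by
    simpa [Matrix.fromCols_mulVec] using hv' (Sum.elim y 0)
  have hv₂ (y : Fin l₂ → K) : symp p (restr A (G₂ *ᵥ y)) v = 0 := by
    simpa [Matrix.fromCols_mulVec] using hv' (Sum.elim 0 y)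
  obtain ⟨c, hc, hcσ⟩ := exists_weyl_mul_reduced_eq_smul hG₁ hind rfl hψ A hv₁
  have key (m : Fin l → K) : weyl p v * reduced A ((linearCQSS p G₂ F ψ recover).state m) =
      (ZMod.stdAddChar (symp p (restr A (F *ᵥ m)) v) * c) •
        reduced A ((linearCQSS p G₂ F ψ recover).state m) := by
    -- Orthogonality of `v` to the `G₂` part makes the phase independent of `u`, so it survives the
    -- average.
    have hs (u : Fin l₂ → K) :
        symp p (restr A (F *ᵥ m + G₂ *ᵥ u)) v = symp p (restr A (F *ᵥ m)) v := by
      rw [map_add, symp_eq_trace, LinearMap.map_add₂, map_add, ← symp_eq_trace, ← symp_eq_trace,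
        hv₂, add_zero]
    simp only [reduced_linearCQSS_state, mul_smul_comm, Finset.mul_sum, weyl_mul_weyl_conj p _ hcσ,
      hs]
    rw [← Finset.smul_sum, smul_comm]
  have h1 := congrArg Matrix.trace (key m)
  rw [hsec m 0, key 0, Matrix.trace_smul, Matrix.trace_smul,
    trace_reduced_linearCQSS_state A hψ, smul_eq_mul, smul_eq_mul, mul_one, mul_one] at h1
  have hc0 : c ≠ 0 := by
    rintro rfl
    simp at hc
  refine stdAddChar_ne_one p hd ?_
  rw [← mul_right_cancel₀ hc0 h1]
  simp [symp]

end Protocol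

end Quantum

end LinearQSS

end

/-! ### The equivalence of the three conditions. -/

open LinearQSS in
theorem theorem1 (p : ℕ) [Fact p.Prime] {K : Type*} [Field K] [Fintype K] [DecidableEq K]
    [Algebra (ZMod p) K] {n l₂ l : ℕ}
    (G₁ : Matrix (Fin n ⊕ Fin n) (Fin n) K) (G₂ : Matrix (Fin n ⊕ Fin n) (Fin l₂) K)
    (F : Matrix (Fin n ⊕ Fin n) (Fin l) K)
    (hG₁ : SelfColumnOrthogonal p G₁) (hind : LinearIndependent K G₁.col)
    (𝔄 𝔅 : Set (Finset (Fin n))) :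
    (∃ ψ, IsStabilizerState p G₁ ψ) ∧
      ∀ ψ, IsStabilizerState p G₁ ψ →
        List.TFAE [
          ∃ recover, (linearCQSS p G₂ F ψ recover).Secure 𝔄 𝔅,
          LinearCSSSecure (Matrix.fromCols G₁ G₂) F (symplectify 𝔄) (symplectify 𝔅),
          IsMMSP (Matrix.fromCols G₁ G₂) F (symplectify 𝔄) (symplectify 𝔅)] := by
  refine ⟨hG₁.exists_isStabilizerState, fun ψ hψ => ?_⟩
  rw [linearCSSSecure_iff, isMMSP_iff]
  simp only [symplectify, Set.forall_mem_image, determines_projLinear_disjSum_iff,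
    masks_projLinear_disjSum_iff]
  tfae_have 2 ↔ 3 := Iff.rfl
  tfae_have 1 → 2 := by
    rintro ⟨recover, hcorr, hsec⟩
    exact ⟨fun A hA => determines_of_correct A hψ (hcorr A hA).2,
      fun B hB => masks_of_secret B hψ hG₁ hind (hsec B hB)⟩
  tfae_have 2 → 1 := by
    rintro ⟨hdet, hmask⟩
    -- The membership `A ∈ 𝔄` sits inside the existential so that `choose` yields a decoder for
    -- every `A`, zero outside `𝔄`.
    have hdec (A : Finset (Fin n)) : ∃ dec : ({i // i ∈ A} ⊕ {i // i ∈ A} → K) → (Fin l → K),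
        A ∈ 𝔄 → ∀ m y, dec (restr A (F *ᵥ m + Matrix.fromCols G₁ G₂ *ᵥ y)) = m := by
      by_cases hA : A ∈ 𝔄
      · obtain ⟨dec, h⟩ := (hdet hA).exists_decoder
        exact ⟨dec, fun _ => h⟩
      · exact ⟨0, fun h => absurd h hA⟩
    choose recover hrec using hdec
    refine ⟨recover, fun A hA => ⟨isPOVM_linearCQSS_dec A hψ,
      correct_of_recover A hψ hG₁ hind (hrec A hA)⟩, fun B hB m m' => ?_⟩
    obtain ⟨y, hy⟩ := hmask hB m
    obtain ⟨y', hy'⟩ := hmask hB m'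
    rw [reduced_linearCQSS_state_eq_zero B hψ hy, reduced_linearCQSS_state_eq_zero B hψ hy']
  tfae_finish
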